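/- Let $n\ge 3$ and $k\ge 0$ be integers. The crown $S_n^k$ is the poset on $\{a_1,\dots,a_{n+k}\}\cup\{b_1,\dots,b_{n+k}\}$, with indices read modulo $n+k$, in which the only strict relations are $a_i<b_j$ for $j\notin\{i,i+1,\dots,i+k\}$. A critical pair of a poset is a pair $(x,y)$ of incomparable elements such that $z<x$ implies $z<y$ and $w>y$ implies $w>x$; the critical pairs of $S_n^k$ are the pairs $(a_i,b_j)$ with $j\in\{i,\dots,i+k\}$. Let $G_n^k$ be the graph on the critical pairs of $S_n^k$ in which $(x,y)$ and $(x',y')$ are adjacent if and only if $x<y'$ and $x'<y$. A set $S$ of critical pairs is reversible if some linear extension $L$ of $S_n^k$ has $x>y$ in $L$ for all $(x,y)\in S$. Let $\tau_j$ ($j\in\mathbb Z/(n+k)$) and $\phi$ be the automorphisms of $S_n^k$ given by $\tau_j(a_i)=a_{i+j}$, $\tau_j(b_i)=b_{i+j}$ and $\phi(a_i)=a_{-i}$, $\phi(b_i)=b_{k-i}$; they act on critical pairs coordinatewise. Suppose that $k<n\le 2k$. Then the following hold. 1. Every independent, non-reversible set $S$ in $G_n^k$ satisfies $$|S|\le 2+\frac{(2k+2-n)(2k+1-n)}{2}.$$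 2. The set $$D=\{(a_i,b_j):1\le i\le j\le 2k+1-n\}\cup\{(a_{k+1},b_{k+1}),(a_{2k+1},b_{2k+1})\}$$ is independent and non-reversible in $G_n^k$, and attains equality in this bound. 3. If $(n,k)\ne(3,2)$, then every independent, non-reversible set in $G_n^k$ that attains equality is $\tau_j(D)$ or $\tau_j(\phi(D))$ for some $j$. -/

import Mathlib

/-- `(x, y)` is a critical pair of the poset `P`: `x` and `y` are incomparable, everything
below `x` is below `y`, and everything above `y` is above `x`. -/
def IsCriticalPair {P : Type*} [PartialOrder P] (x y : P) : Prop :=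
  IncompRel (· ≤ ·) x y ∧ (∀ z, z < x → z < y) ∧ (∀ w, y < w → x < w)

/-- The set `Crit(P)` of critical pairs, as a type. -/
abbrev CritPair (P : Type*) [PartialOrder P] : Type _ :=
  {p : P × P // IsCriticalPair p.1 p.2}

/-- A set `R` of pairs is reversible if some linear extension `L` of `P` has `x > y` in `L`
for all `(x, y) ∈ R`. -/
def IsReversible {P : Type*} [PartialOrder P] (R : Set (P × P)) : Prop :=
  ∃ L : LinearOrder P, (∀ x y : P, x ≤ y → L.le x y) ∧ ∀ p ∈ R, L.lt p.2 p.1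

/-- An automorphism of a poset preserves critical pairs. -/
theorem IsCriticalPair.map {P : Type*} [PartialOrder P] (f : P ≃o P) {x y : P}
    (h : IsCriticalPair x y) : IsCriticalPair (f x) (f y) := by
  obtain ⟨⟨h₁, h₂⟩, h₃, h₄⟩ := h
  refine ⟨⟨?_, ?_⟩, fun z hz => ?_, fun w hw => ?_⟩
  · simpa using h₁
  · simpa using h₂
  · exact f.symm_apply_lt.1 (h₃ _ (f.symm_apply_lt.2 hz))
  · exact f.lt_symm_apply.1 (h₄ _ (f.lt_symm_apply.2 hw))

/-- The action `(x, y) ↦ (f x, f y)` of an automorphism of a poset on its critical pairs. -/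
def CritPair.map {P : Type*} [PartialOrder P] (f : P ≃o P) (p : CritPair P) : CritPair P :=
  ⟨(f p.1.1, f p.1.2), p.2.map f⟩

/-- The ground set of the crown `S_n^k`: elements `a_i` and `b_i`, where the index `i` is
read cyclically modulo `n + k`. -/
inductive Crown (n k : ℕ) : Type
  | a (i : ZMod (n + k)) : Crown n k
  | b (i : ZMod (n + k)) : Crown n k

namespace Crown

/-- `j` belongs to the cyclic interval `{i, i + 1, …, i + k}`. -/
def InInterval (n k : ℕ) (i j : ZMod (n + k)) : Prop :=
  ∃ t : ℕ, t ≤ k ∧ j = i + (t : ZMod (n + k))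

/-- The order of the crown: besides equalities, `a_i ≤ b_j` exactly when `j` is not in the
cyclic interval `{i, i + 1, …, i + k}`. -/
protected def le {n k : ℕ} : Crown n k → Crown n k → Prop
  | a i, a j => i = j
  | b i, b j => i = j
  | a i, b j => ¬ InInterval n k i j
  | b _, a _ => False

instance (n k : ℕ) : PartialOrder (Crown n k) where
  le := Crown.le
  le_refl x := by cases x <;> simp [Crown.le]
  le_trans x y z := by cases x <;> cases y <;> cases z <;> simp [Crown.le] <;> grind
  le_antisymm x y := by cases x <;> cases y <;> simp +contextual [Crown.le]

/-- The rotation `τ_j`: `a_i ↦ a_{i+j}`, `b_i ↦ b_{i+j}`. -/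
def rotation {n k : ℕ} (j : ZMod (n + k)) : Crown n k ≃o Crown n k where
  toFun
    | a i => a (i + j)
    | b i => b (i + j)
  invFun
    | a i => a (i - j)
    | b i => b (i - j)
  left_inv x := by cases x <;> simp
  right_inv x := by cases x <;> simp
  map_rel_iff' {x y} := by
    cases x with
    | a i =>
      cases y with
      | a i' => exact add_left_inj j
      | b i' =>
        refine not_congr (exists_congr fun t => and_congr_right fun _ => ?_)
        rw [add_right_comm, add_left_inj]
    | b i =>
      cases y with
      | a i' => exact Iff.rfl
      | b i' => exact add_left_inj j

/-- The reflection `φ`: `a_i ↦ a_{-i}`, `b_i ↦ b_{k-i}`. -/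
def reflection {n k : ℕ} : Crown n k ≃o Crown n k where
  toFun
    | a i => a (-i)
    | b i => b ((k : ZMod (n + k)) - i)
  invFun
    | a i => a (-i)
    | b i => b ((k : ZMod (n + k)) - i)
  left_inv x := by cases x <;> simp
  right_inv x := by cases x <;> simp
  map_rel_iff' {x y} := by
    cases x with
    | a i =>
      cases y with
      | a j => exact neg_inj
      | b j =>
        refine not_congr ⟨?_, ?_⟩
        · rintro ⟨t, ht, h⟩
          refine ⟨k - t, Nat.sub_le _ _, ?_⟩
          rw [Nat.cast_sub ht]
          linear_combination -h
        · rintro ⟨t, ht, h⟩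
          refine ⟨k - t, Nat.sub_le _ _, ?_⟩
          rw [Nat.cast_sub ht]
          linear_combination -h
    | b i =>
      cases y with
      | a j => exact Iff.rfl
      | b j => exact sub_right_inj

/-- The graph `G_n^k` of critical pairs of the crown `S_n^k`: the pairs `(x, y)` and `(x', y')`
are adjacent iff `x < y'` and `x' < y`. -/
def graph (n k : ℕ) : SimpleGraph (CritPair (Crown n k)) where
  Adj p q := p.1.1 < q.1.2 ∧ q.1.1 < p.1.2
  symm := ⟨fun _ _ h => ⟨h.2, h.1⟩⟩
  loopless := ⟨fun p h => p.2.1.1 h.1.le⟩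

/-- An independent set of `G_n^k` that is not reversible. -/
def IsINR {n k : ℕ} (S : Set (CritPair (Crown n k))) : Prop :=
  (graph n k).IsIndepSet S ∧ ¬ IsReversible (Subtype.val '' S)

/-- The down set generated by pairs `(a_p, b_q)`, `(p, q) ∈ C`, for inclusion of clockwise arcs:
all `(a_i, b_j)` such that for some `(p, q) ∈ C`, going clockwise around the circle `ℤ/(n+k)`
from `p` to the first visit of `q`, one meets `i` and then (or simultaneously) `j`. -/
def downSet {n k : ℕ} (C : Set (ZMod (n + k) × ZMod (n + k))) : Set (CritPair (Crown n k)) :=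
  {v | ∃ i j : ZMod (n + k), v.1 = (a i, b j) ∧
    ∃ c ∈ C, (i - c.1).val ≤ (j - c.1).val ∧ (j - c.1).val ≤ (c.2 - c.1).val}

/-- The down set generated by `(a_1, b_{2k+1-n})`, `(a_{k+1}, b_{k+1})`, `(a_{2k+1}, b_{2k+1})`
(used only for `n ≤ 2k`, so that the subtraction is not truncated). -/
def extremalSet (n k : ℕ) : Set (CritPair (Crown n k)) :=
  downSet {(1, ((2 * k + 1 - n : ℕ) : ZMod (n + k))),
    (((k + 1 : ℕ) : ZMod (n + k)), ((k + 1 : ℕ) : ZMod (n + k))),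
    (((2 * k + 1 : ℕ) : ZMod (n + k)), ((2 * k + 1 : ℕ) : ZMod (n + k)))}

end Crown

theorem isReversible_of_forall_not_transGen {P : Type*} [PartialOrder P] {R : Set (P × P)}
    (h : ∀ p, ¬ Relation.TransGen (fun p q => p ∈ R ∧ q ∈ R ∧ p.1 ≤ q.2) p p) :
    IsReversible R := by
  set A : P × P → P × P → Prop := fun p q => p ∈ R ∧ q ∈ R ∧ p.1 ≤ q.2
  let r : P → P → Prop := fun x y => x ≤ y ∨
    ∃ p q, p ∈ R ∧ q ∈ R ∧ x ≤ p.2 ∧ Relation.ReflTransGen A p q ∧ q.1 ≤ y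
  have key : ∀ {p q : P × P}, p ∈ R → q ∈ R → Relation.ReflTransGen A p q → ¬ q.1 ≤ p.2 :=
    fun hp hq hpq hle => h _ (Relation.TransGen.tail' hpq ⟨hq, hp, hle⟩)
  have : IsPartialOrder P r :=
    { refl := fun x => Or.inl le_rfl
      trans := by
        rintro x y z (hxy | ⟨p, q, hp, hq, hxp, hpq, hqy⟩) (hyz | ⟨p', q', hp', hq', hyp, hpq', hqz⟩)
        · exact Or.inl (hxy.trans hyz)
        · exact Or.inr ⟨p', q', hp', hq', hxy.trans hyp, hpq', hqz⟩
        · exact Or.inr ⟨p, q, hp, hq, hxp, hpq, hqy.trans hyz⟩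
        · exact Or.inr ⟨p, q', hp, hq', hxp,
            (hpq.tail ⟨hq, hp', hqy.trans hyp⟩).trans hpq', hqz⟩
      antisymm := by
        rintro x y (hxy | ⟨p, q, hp, hq, hxp, hpq, hqy⟩) (hyx | ⟨p', q', hp', hq', hyp, hpq', hqx⟩)
        · exact le_antisymm hxy hyx
        · exact absurd (hqx.trans (hxy.trans hyp)) (key hp' hq' hpq')
        · exact absurd (hqy.trans (hyx.trans hxp)) (key hp hq hpq)
        · exact absurd (hqx.trans hxp)
            (key hp hq' ((hpq.tail ⟨hq, hp', hqy.trans hyp⟩).trans hpq')) }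
  obtain ⟨s, hs, hrs⟩ := extend_partialOrder r
  classical
  refine ⟨{ le := s
            lt := fun x y => s x y ∧ ¬ s y x
            lt_iff_le_not_ge := fun _ _ => Iff.rfl
            le_refl := hs.refl
            le_trans := fun _ _ _ => hs.trans _ _ _
            le_antisymm := fun _ _ => hs.antisymm _ _
            le_total := hs.total
            toDecidableLE := Classical.decRel _ }, fun x y hxy => hrs _ _ (Or.inl hxy), ?_⟩
  intro p hp
  have h1 : s p.2 p.1 := hrs _ _ (Or.inr ⟨p, p, hp, hp, le_rfl, .refl, le_rfl⟩)
  refine ⟨h1, fun h2 => ?_⟩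
  exact key hp hp .refl (hs.antisymm _ _ h2 h1).le

namespace Crown

variable {n k : ℕ}

theorem a_le_b_iff {i j : ZMod (n + k)} : (a i : Crown n k) ≤ b j ↔ ¬ InInterval n k i j := Iff.rfl

theorem a_lt_b_iff {i j : ZMod (n + k)} : (a i : Crown n k) < b j ↔ ¬ InInterval n k i j :=
  ⟨fun h => h.le, fun h => lt_of_le_of_ne h (by simp)⟩

theorem not_lt_a {x : Crown n k} {i : ZMod (n + k)} : ¬ x < a i := fun h => by
  cases x with
  | a j => exact h.ne (congrArg a (show j = i from h.le))
  | b j => exact h.le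

theorem not_b_lt {x : Crown n k} {i : ZMod (n + k)} : ¬ b i < x := fun h => by
  cases x with
  | a j => exact h.le
  | b j => exact h.ne (congrArg b (show i = j from h.le))

theorem inInterval_self (i : ZMod (n + k)) : InInterval n k i i := ⟨0, Nat.zero_le _, by simp⟩

theorem isCriticalPair_a_b {i j : ZMod (n + k)} (h : InInterval n k i j) :
    IsCriticalPair (a i : Crown n k) (b j) :=
  ⟨⟨fun h' => a_le_b_iff.1 h' h, fun h' => h'⟩, fun _ h' => absurd h' not_lt_a,
    fun _ h' => absurd h' not_b_lt⟩

/-- Two residues in a common window of length less than the modulus are equal as integers. -/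
theorem intCast_eq_of_lt {i j : ℤ} (h : (i : ZMod (n + k)) = j) (h₁ : i < j + (n + k))
    (h₂ : j < i + (n + k)) : i = j := by
  rw [ZMod.intCast_eq_intCast_iff_dvd_sub] at h
  obtain ⟨q, hq⟩ := h
  push_cast at hq
  have : q = 0 := by nlinarith
  subst this
  linarith

theorem intCast_add_modulus (i : ℤ) : ((i + (n + k) : ℤ) : ZMod (n + k)) = i := by
  have := ZMod.natCast_self (n + k)
  push_cast at this ⊢
  rw [this, add_zero]

theorem inInterval_intCast_iff {i : ℤ} {y : ZMod (n + k)} :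
    InInterval n k i y ↔ ∃ j : ℤ, (j : ZMod (n + k)) = y ∧ i ≤ j ∧ j ≤ i + k := by
  constructor
  · rintro ⟨t, ht, rfl⟩
    exact ⟨i + t, by push_cast; rfl, by omega, by omega⟩
  · rintro ⟨j, rfl, h₁, h₂⟩
    refine ⟨(j - i).toNat, by omega, ?_⟩
    have : (((j - i).toNat : ℤ) : ZMod (n + k)) = ((j - i : ℤ) : ZMod (n + k)) := by
      rw [Int.toNat_of_nonneg (by omega)]
    push_cast at this
    rw [this]
    ring

theorem inInterval_iff_exists_left {x : ZMod (n + k)} {j : ℤ} :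
    InInterval n k x j ↔ ∃ i : ℤ, (i : ZMod (n + k)) = x ∧ i ≤ j ∧ j ≤ i + k := by
  constructor
  · rintro ⟨t, ht, h⟩
    exact ⟨j - t, by push_cast; rw [h]; ring, by omega, by omega⟩
  · rintro ⟨i, rfl, h₁, h₂⟩
    exact inInterval_intCast_iff.2 ⟨j, rfl, h₁, h₂⟩

/-- Every residue has a representative in any window of full length. -/
theorem exists_intCast_eq (hm : 0 < n + k) (i : ℤ) (y : ZMod (n + k)) :
    ∃ j : ℤ, (j : ZMod (n + k)) = y ∧ i ≤ j ∧ j < i + (n + k) := by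
  have : NeZero (n + k) := ⟨hm.ne'⟩
  refine ⟨i + (y - (i : ZMod (n + k))).val, ?_, by omega, ?_⟩
  · push_cast
    rw [ZMod.natCast_zmod_val]
    ring
  · have := ZMod.val_lt (y - (i : ZMod (n + k)))
    omega

theorem exists_of_isCriticalPair (hkn : k < n) (hk : 0 < k) {x y : Crown n k}
    (h : IsCriticalPair x y) : ∃ i j, x = a i ∧ y = b j ∧ InInterval n k i j := by
  obtain ⟨⟨h₁, h₂⟩, h₃, h₄⟩ := h
  cases x with
  | a i =>
    cases y with
    | b j => exact ⟨i, j, rfl, rfl, not_not.1 h₁⟩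
    | a j =>
      exfalso
      have key : ∀ l, InInterval n k i l → InInterval n k j l := fun l hl => by
        by_contra hc
        exact a_lt_b_iff.1 (h₄ (b l) (a_lt_b_iff.2 hc)) hl
      obtain ⟨s, hs, hs'⟩ := key i (inInterval_self i)
      obtain ⟨t, ht, ht'⟩ := key (i + k) ⟨k, le_rfl, rfl⟩
      have e : (((s + k : ℕ) : ℤ) : ZMod (n + k)) = ((t : ℤ) : ZMod (n + k)) := by
        push_cast
        rw [hs'] at ht'
        linear_combination ht'
      have := intCast_eq_of_lt e (by omega) (by omega)
      have hs0 : s = 0 := by omega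
      subst hs0
      exact h₁ (show i = j by simpa using hs')
  | b i =>
    exfalso
    cases y with
    | a j =>
      refine not_lt_a (h₃ (a (i + 1)) (a_lt_b_iff.2 ?_))
      rintro ⟨t, ht, ht'⟩
      have e : (((t + 1 : ℕ) : ℤ) : ZMod (n + k)) = ((0 : ℤ) : ZMod (n + k)) := by
        push_cast
        linear_combination -ht'
      have := intCast_eq_of_lt e (by omega) (by omega)
      omega
    | b j =>
      have key : ∀ l, InInterval n k l j → InInterval n k l i := fun l hl => by
        by_contra hc
        exact a_lt_b_iff.1 (h₃ (a l) (a_lt_b_iff.2 hc)) hl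
      obtain ⟨s, hs, hs'⟩ := key j (inInterval_self j)
      obtain ⟨t, ht, ht'⟩ := key (j - k) ⟨k, le_rfl, by ring⟩
      have e : (((s + k : ℕ) : ℤ) : ZMod (n + k)) = ((t : ℤ) : ZMod (n + k)) := by
        push_cast
        rw [hs'] at ht'
        linear_combination ht'
      have := intCast_eq_of_lt e (by omega) (by omega)
      have hs0 : s = 0 := by omega
      subst hs0
      exact h₁ (show i = j by simpa using hs')

end Crown

namespace Crown

/-- A periodic family of arcs `[i, i + t]` on the line, the lift of an independent set of arcs
`[i, i + t]`, `0 ≤ t ≤ k`, on a circle with `n + k` points. -/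
structure IsArcFamily (n k : ℤ) (P : ℤ → ℤ → Prop) : Prop where
  nonneg : ∀ {i t}, P i t → 0 ≤ t
  le : ∀ {i t}, P i t → t ≤ k
  add : ∀ {i t}, P i t → P (i + (n + k)) t
  sub : ∀ {i t}, P i t → P (i - (n + k)) t
  near : ∀ {i t j u}, P i t → P j u → i < j → j ≤ i + k → j ≤ i + t ∨ j + u ≤ i + k
  far : ∀ {i t j u}, P i t → P j u → i + k < j → j < i + n → False

/-- Three disjoint arcs starting at `x < y < z`, consecutive starting points being at distance at
most `k` on the circle. -/
def IsTriangle (n k : ℤ) (P : ℤ → ℤ → Prop) (x y z : ℤ) : Prop :=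
  ∃ r s t, P x r ∧ P y s ∧ P z t ∧ x + r < y ∧ y + s < z ∧ z + t < x + (n + k) ∧
    y ≤ x + k ∧ z ≤ y + k ∧ x + n ≤ z

variable {n k : ℤ} {P : ℤ → ℤ → Prop} {x y z : ℤ}

theorem IsTriangle.rotate (hP : IsArcFamily n k P) (h : IsTriangle n k P x y z) :
    IsTriangle n k P y z (x + (n + k)) := by
  obtain ⟨r, s, t, hx, hy, hz, h⟩ := h
  exact ⟨s, t, r, hy, hz, hP.add hx, by omega⟩

theorem IsTriangle.sub (hP : IsArcFamily n k P) (h : IsTriangle n k P x y z) :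
    IsTriangle n k P (x - (n + k)) (y - (n + k)) (z - (n + k)) := by
  obtain ⟨r, s, t, hx, hy, hz, h⟩ := h
  exact ⟨r, s, t, hP.sub hx, hP.sub hy, hP.sub hz, by omega⟩

theorem IsTriangle.rotate_back (hP : IsArcFamily n k P) (h : IsTriangle n k P y z (x + (n + k))) :
    IsTriangle n k P x y z := by
  have := (h.rotate hP).rotate hP |>.sub hP
  simpa using this

/-- An arc starting in `[x, y)` either ends at distance at most `k` from the preceding vertex `z`
of the triangle, or can replace `y` in the triangle. -/
theorem IsTriangle.locate (hP : IsArcFamily n k P) (hkn : k < n) (h : IsTriangle n k P x y z)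
    {w t : ℤ} (hw : P w t) (hxw : x ≤ w) (hwy : w < y) :
    (w + t + (n + k) ≤ z + k ∧ IsTriangle n k P w y z) ∨
      (z ≤ w + k ∧ w + t ≤ x + k ∧ IsTriangle n k P x w z) := by
  obtain ⟨r, s, u, hx, hy, hz, h₁, h₂, h₃, h₄, h₅, h₆⟩ := h
  have hx' := hP.add hx
  have hw' := hP.add hw
  have r0 := hP.nonneg hx
  have s0 := hP.nonneg hy
  have u0 := hP.nonneg hz
  have t0 := hP.nonneg hw
  have tk := hP.le hw
  have c₁ := hP.near hz hx' (by omega) (by omega)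
  have c₂ := hP.near hx hy (by omega) (by omega)
  have c₃ := hP.near hy hz (by omega) (by omega)
  rcases lt_or_ge (w + k) z with hz' | hz'
  · left
    have c₄ : z + k ≥ w + (n + k) := by
      by_contra hc
      exact hP.far hw hz (by omega) (by omega)
    have c₅ := hP.near hz hw' (by omega) (by omega)
    exact ⟨by omega, t, s, u, hw, hy, hz, by omega⟩
  · right
    have hne : x ≠ w := by
      rintro rfl
      omega
    have c₄ := hP.near hx hw (by omega) (by omega)
    have c₅ := hP.near hw hz (by omega) (by omega)
    exact ⟨by omega, by omega, r, t, u, hx, hw, hz, by omega⟩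

theorem exists_minimal_isTriangle (hP : IsArcFamily n k P) (h : IsTriangle n k P x y z) :
    ∃ x y z, IsTriangle n k P x y z ∧ (∀ x' y' z', IsTriangle n k P x' y' z' → y - x ≤ y' - x') ∧
      ∀ z', IsTriangle n k P x y z' → z ≤ z' := by
  have lt : ∀ {x y z}, IsTriangle n k P x y z → x < y ∧ y < z := by
    rintro x y z ⟨r, s, t, hx, hy, hz, h⟩
    have := hP.nonneg hx
    have := hP.nonneg hy
    omega
  obtain ⟨d, ⟨x, y, ⟨z₀, hz₀⟩, rfl⟩, hd⟩ := Int.exists_least_of_bdd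
    (P := fun d => ∃ x y, (∃ z, IsTriangle n k P x y z) ∧ d = y - x)
    ⟨0, by rintro _ ⟨x, y, ⟨z, hz⟩, rfl⟩; have := lt hz; omega⟩ ⟨_, x, y, ⟨z, h⟩, rfl⟩
  obtain ⟨z, hz, hz'⟩ := Int.exists_least_of_bdd (P := fun z => IsTriangle n k P x y z)
    ⟨y, fun z hz => (lt hz).2.le⟩ ⟨z₀, hz₀⟩
  exact ⟨x, y, z, hz, fun x' y' z' h' => hd _ ⟨x', y', ⟨z', h'⟩, rfl⟩, hz'⟩

/-- The position of all arcs relative to a minimal triangle. -/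
theorem IsTriangle.exists_position (hP : IsArcFamily n k P) (hkn : k < n)
    (h : IsTriangle n k P x y z)
    (hxy : ∀ x' y' z', IsTriangle n k P x' y' z' → y - x ≤ y' - x')
    (hz : ∀ z', IsTriangle n k P x y z' → z ≤ z') {w t : ℤ} (hw : P w t) (hxw : x ≤ w)
    (hwx : w < x + (n + k)) :
    (w = x ∧ x + t + n ≤ z) ∨ (y ≤ w ∧ w + t ≤ x + k) ∨ (z ≤ w ∧ w + t ≤ y + k) ∨
      (y + n ≤ w ∧ w + t ≤ z + k ∧ y - x ≤ w - z) := by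
  rcases lt_or_ge w y with h₁ | h₁
  · rcases h.locate hP hkn hw hxw h₁ with ⟨h₂, h₃⟩ | ⟨-, -, h₃⟩
    · have := hxy _ _ _ h₃
      left
      omega
    · have := hxy _ _ _ h₃
      omega
  rcases lt_or_ge w z with h₂ | h₂
  · rcases (h.rotate hP).locate hP hkn hw h₁ h₂ with ⟨h₃, -⟩ | ⟨-, -, h₃⟩
    · omega
    · have := hz _ (h₃.rotate_back hP)
      omega
  · rcases ((h.rotate hP).rotate hP).locate hP hkn hw h₂ hwx with ⟨h₃, -⟩ | ⟨h₃, h₄, h₅⟩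
    · omega
    · have := hxy _ _ _ h₅
      omega

theorem IsTriangle.conflict (hP : IsArcFamily n k P) (hkn : k < n) (h : IsTriangle n k P x y z)
    {v w t u : ℤ} (hv : P v t) (hw : P w u) (h₁ : y ≤ v + k)
    (h₃ : v + t + n ≤ z) (h₄ : y ≤ w) (h₅ : w + u ≤ x + k) (h₆ : v + k < w + u)
    (h₇ : w < v + t + n) : False := by
  obtain ⟨r, s, q, hx, hy, hz, g₁, g₂, g₃, g₄, g₅, g₆⟩ := h
  have := hP.nonneg hx
  have := hP.nonneg hw
  have := hP.nonneg hv
  rcases lt_or_ge (v + k) w with hc | hc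
  · rcases lt_or_ge w (v + n) with hc' | hc'
    · exact hP.far hv hw hc hc'
    · have := hP.near hw (hP.add hv) (by omega) (by omega)
      omega
  · have := hP.near hv hw (by omega) (by omega)
    omega

end Crown

namespace Crown

/-- The pairs `0 ≤ e ≤ f ≤ c`. -/
noncomputable def pairsLE (c : ℤ) : Finset (ℤ × ℤ) :=
  (Finset.Icc 0 c ×ˢ Finset.Icc 0 c).filter fun p => p.1 ≤ p.2

theorem mem_pairsLE {c : ℤ} {p : ℤ × ℤ} : p ∈ pairsLE c ↔ 0 ≤ p.1 ∧ p.1 ≤ p.2 ∧ p.2 ≤ c := by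
  simp only [pairsLE, Finset.mem_filter, Finset.mem_product, Finset.mem_Icc]
  omega

theorem two_mul_card_pairsLE {c : ℤ} (hc : 0 ≤ c) :
    2 * ((pairsLE c).card : ℤ) = (c + 1) * (c + 2) := by
  lift c to ℕ using hc
  induction c with
  | zero => decide
  | succ c ih =>
    have : pairsLE ((c + 1 : ℕ) : ℤ) =
        pairsLE c ∪ Finset.Icc (0 : ℤ) (c + 1) ×ˢ {(c + 1 : ℤ)} := by
      ext ⟨e, f⟩
      simp only [mem_pairsLE, Finset.mem_union, Finset.mem_product, Finset.mem_Icc,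
        Finset.mem_singleton]
      omega
    rw [this, Finset.card_union_of_disjoint, Finset.card_product, Int.card_Icc]
    · push_cast
      simp only [Finset.card_singleton, Nat.cast_one, mul_one, sub_zero]
      rw [Int.toNat_of_nonneg (by positivity)]
      linear_combination ih
    · rw [Finset.disjoint_left]
      rintro ⟨e, f⟩ h₁ h₂
      simp only [mem_pairsLE, Finset.mem_product, Finset.mem_Icc, Finset.mem_singleton] at h₁ h₂
      omega

/-- Sends the arc `[x - e, x - s]`, encoded as `(s, e)`, to an arc `[y + e', y + f']` in conflict
with it, encoded as `(e', f')`. -/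
def conflictMap (c : ℤ) (p : ℤ × ℤ) : ℤ × ℤ :=
  if 1 ≤ p.1 then (c - p.2, c - p.1 + 1)
  else if p.1 = 0 then (c - p.2 + 1, c - p.2 + 1)
  else (-p.1 - 1, c - p.2 + 1)

open Classical in
/-- Offsets of the arcs `[y + e, y + f]`, `0 ≤ e ≤ f ≤ c`, of a family. -/
noncomputable def arcsAfter (P : ℤ → ℤ → Prop) (c y : ℤ) : Finset (ℤ × ℤ) :=
  (pairsLE c).filter fun p => P (y + p.1) (p.2 - p.1)

open Classical in
/-- Offsets of the arcs `[x - e, x - s]`, `1 ≤ e ≤ c - d`, `-d ≤ s ≤ e`, of a family. -/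
noncomputable def arcsBefore (P : ℤ → ℤ → Prop) (c d x : ℤ) : Finset (ℤ × ℤ) :=
  (Finset.Icc (-d) c ×ˢ Finset.Icc 1 (c - d)).filter fun p =>
    p.1 ≤ p.2 ∧ P (x - p.2) (p.2 - p.1)

variable {n k : ℤ} {P : ℤ → ℤ → Prop} {x y z : ℤ}

theorem IsArcFamily.add_mul (hP : IsArcFamily n k P) {i t : ℤ} (h : P i t) (q : ℤ) :
    P (i + q * (n + k)) t := by
  induction q with
  | zero => simpa using h
  | succ q ih => convert hP.add ih using 1; ring
  | pred q ih => convert hP.sub ih using 1; ring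

theorem mem_arcsAfter {c : ℤ} {p : ℤ × ℤ} : p ∈ arcsAfter P c y ↔
    0 ≤ p.1 ∧ p.1 ≤ p.2 ∧ p.2 ≤ c ∧ P (y + p.1) (p.2 - p.1) := by
  classical
  rw [arcsAfter, Finset.mem_filter, mem_pairsLE]
  tauto

theorem mem_arcsBefore {c d : ℤ} (hd : 0 ≤ d) {p : ℤ × ℤ} : p ∈ arcsBefore P c d x ↔
    -d ≤ p.1 ∧ p.1 ≤ p.2 ∧ 1 ≤ p.2 ∧ p.2 ≤ c - d ∧ P (x - p.2) (p.2 - p.1) := by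
  classical
  rw [arcsBefore, Finset.mem_filter, Finset.mem_product, Finset.mem_Icc, Finset.mem_Icc]
  constructor
  · tauto
  · rintro ⟨h₁, h₂, h₃, h₄, h₅⟩
    exact ⟨⟨⟨h₁, by omega⟩, h₃, h₄⟩, h₂, h₅⟩

theorem conflictMap_injOn (c : ℤ) {d : ℤ} (hd : 0 ≤ d) :
    Set.InjOn (conflictMap c) (arcsBefore P c d x) := by
  rintro ⟨s, e⟩ h ⟨s', e'⟩ h' heq
  rw [Finset.mem_coe, mem_arcsBefore hd] at h h'
  simp only [conflictMap] at h h' heq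
  rw [Prod.mk.injEq]
  split_ifs at heq <;> rw [Prod.mk.injEq] at heq <;> omega

theorem IsTriangle.disjoint_arcs (hP : IsArcFamily n k P) (hkn : k < n)
    (h : IsTriangle n k P x y z) (hd : x + n ≤ z) :
    Disjoint (arcsAfter P (x + k - y) y)
      ((arcsBefore P (x + k - y) (z - n - x) x).image (conflictMap (x + k - y))) := by
  rw [Finset.disjoint_left]
  rintro p hp hp'
  obtain ⟨⟨s, e⟩, hq, rfl⟩ := Finset.mem_image.1 hp'
  rw [mem_arcsBefore (by omega)] at hq
  rw [mem_arcsAfter] at hp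
  obtain ⟨h₁, h₂, h₃, h₄, h₅⟩ := hq
  obtain ⟨g₁, g₂, g₃, g₄⟩ := hp
  simp only at h₁ h₂ h₃ h₄ h₅
  refine h.conflict hP hkn h₅ g₄ ?_ ?_ ?_ ?_ ?_ ?_ <;> clear g₄ h₅ <;>
    simp only [conflictMap] at * <;> split_ifs at * <;> simp only at * <;> omega

theorem image_conflictMap_subset {c d : ℤ} (hd : 0 ≤ d) :
    (arcsBefore P c d x).image (conflictMap c) ⊆ pairsLE c := by
  intro p hp
  obtain ⟨⟨s, e⟩, hq, rfl⟩ := Finset.mem_image.1 hp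
  rw [mem_arcsBefore hd] at hq
  rw [mem_pairsLE]
  simp only [conflictMap] at *
  split_ifs <;> simp only <;> omega

theorem arcsAfter_subset {c : ℤ} : arcsAfter P c y ⊆ pairsLE c := by
  classical exact Finset.filter_subset _ _

/-- The independent-set bound: up to rotation, the family is covered by a small set of arcs; if
that set has the largest possible size, the family is contained in an extremal one. -/
theorem IsTriangle.exists_cover (hP : IsArcFamily n k P) (hkn : k < n)
    (h : IsTriangle n k P x y z) : ∃ A : Finset (ℤ × ℤ),
      (∀ w t, P w t → ∃ v, (v, t) ∈ A ∧ n + k ∣ v - w) ∧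
      2 * (A.card : ℤ) ≤ 4 + (2 * k - n + 1) * (2 * k - n + 2) ∧
      (2 * (A.card : ℤ) = 4 + (2 * k - n + 1) * (2 * k - n + 2) → ¬ (n = 3 ∧ k = 2) →
        ∃ y, ∀ w t, P w t → ∃ v, n + k ∣ v - w ∧ ((y ≤ v ∧ v + t ≤ y + (2 * k - n)) ∨
          (v = y + k ∧ t = 0) ∨ (v = y + 2 * k ∧ t = 0))) := by
  obtain ⟨x, y, z, h, hxy, hz⟩ := exists_minimal_isTriangle hP h
  have hc01 := hxy _ _ _ (h.rotate hP)
  have ⟨_, _, _, _, _, _, _, _, _, hc0, hc1, hc2⟩ := h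
  obtain ⟨c₀, hc₀⟩ : ∃ c, c = x + k - y := ⟨_, rfl⟩
  obtain ⟨c₁, hc₁⟩ : ∃ c, c = y + k - z := ⟨_, rfl⟩
  obtain ⟨c₂, hc₂⟩ : ∃ c, c = z - n - x := ⟨_, rfl⟩
  have hpos : ∀ w t, P w t → ∃ v, P v t ∧ n + k ∣ v - w ∧
      ((v = x ∧ 0 ≤ t ∧ t ≤ c₂) ∨ (y ≤ v ∧ 0 ≤ t ∧ v + t ≤ y + c₀) ∨
        (z ≤ v ∧ 0 ≤ t ∧ v + t ≤ z + c₁) ∨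
        (x - (c₀ - c₂) ≤ v ∧ v < x ∧ 0 ≤ t ∧ v + t ≤ x + c₂)) := by
    intro w t hw
    have t0 := hP.nonneg hw
    have hm : 0 < n + k := by omega
    obtain ⟨v, hv, hdvd, hxv, hvx⟩ : ∃ v, P v t ∧ n + k ∣ v - w ∧ x ≤ v ∧ v < x + (n + k) := by
      refine ⟨w + -((w - x) / (n + k)) * (n + k), hP.add_mul hw _, ⟨-((w - x) / (n + k)), by ring⟩,
        ?_, ?_⟩
      · have := Int.emod_nonneg (w - x) hm.ne'
        rw [Int.emod_def] at this
        linarith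
      · have := Int.emod_lt_of_pos (w - x) hm
        rw [Int.emod_def] at this
        linarith
    rcases h.exists_position hP hkn hxy hz hv hxv hvx with g | g | g | g
    · exact ⟨v, hv, hdvd, by omega⟩
    · exact ⟨v, hv, hdvd, by omega⟩
    · exact ⟨v, hv, hdvd, by omega⟩
    · refine ⟨v - (n + k), hP.sub hv, ?_, by omega⟩
      rw [sub_right_comm]
      exact hdvd.sub dvd_rfl
  set W := arcsAfter P c₀ y with hW
  set Z := arcsBefore P c₀ c₂ x with hZ
  have hdis : Disjoint W (Z.image (conflictMap c₀)) := by
    have := h.disjoint_arcs hP hkn hc2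
    rwa [← hc₀, ← hc₂] at this
  have hsub : W ∪ Z.image (conflictMap c₀) ⊆ pairsLE c₀ :=
    Finset.union_subset arcsAfter_subset (image_conflictMap_subset (by omega))
  have hcard : (W.card : ℤ) + Z.card = (W ∪ Z.image (conflictMap c₀)).card := by
    rw [Finset.card_union_of_disjoint hdis,
      Finset.card_image_of_injOn (conflictMap_injOn c₀ (by omega))]
    push_cast
    rfl
  have hle : (W.card : ℤ) + Z.card ≤ (pairsLE c₀).card := by
    rw [hcard]
    exact_mod_cast Finset.card_le_card hsub
  have t₀ := two_mul_card_pairsLE (c := c₀) (by omega)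
  have t₁ := two_mul_card_pairsLE (c := c₁) (by omega)
  let A : Finset (ℤ × ℤ) := (W.image fun p => (y + p.1, p.2 - p.1)) ∪
    (Z.image fun p => (x - p.2, p.2 - p.1)) ∪
    ((pairsLE c₁).image fun p => (z + p.1, p.2 - p.1)) ∪ ({x} ×ˢ Finset.Icc 0 c₂)
  have hA : (A.card : ℤ) ≤ W.card + Z.card + (pairsLE c₁).card + (c₂ + 1) := by
    have e₁ := Finset.card_union_le ((W.image fun p => (y + p.1, p.2 - p.1)) ∪
      (Z.image fun p => (x - p.2, p.2 - p.1)) ∪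
      ((pairsLE c₁).image fun p => (z + p.1, p.2 - p.1))) ({x} ×ˢ Finset.Icc 0 c₂)
    have e₂ := Finset.card_union_le ((W.image fun p => (y + p.1, p.2 - p.1)) ∪
      (Z.image fun p => (x - p.2, p.2 - p.1)))
      ((pairsLE c₁).image fun p => (z + p.1, p.2 - p.1))
    have e₃ := Finset.card_union_le (W.image fun p => (y + p.1, p.2 - p.1))
      (Z.image fun p => (x - p.2, p.2 - p.1))
    have e₄ := Finset.card_image_le (s := W) (f := fun p => (y + p.1, p.2 - p.1))
    have e₅ := Finset.card_image_le (s := Z) (f := fun p => (x - p.2, p.2 - p.1))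
    have e₆ := Finset.card_image_le (s := pairsLE c₁) (f := fun p => (z + p.1, p.2 - p.1))
    have e₇ : ({x} ×ˢ Finset.Icc 0 c₂ : Finset (ℤ × ℤ)).card = (c₂ + 1).toNat := by simp
    change A.card ≤ _ at e₁
    omega
  have hC : 2 * k - n = c₀ + c₁ + c₂ := by omega
  have p₀ : 0 ≤ c₀ := by omega
  have p₁ : 0 ≤ c₁ := by omega
  have p₂ : 0 ≤ c₂ := by omega
  refine ⟨A, ?_, ?_, ?_⟩
  · intro w t hw
    obtain ⟨v, hv, hvw, hcases⟩ := hpos w t hw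
    refine ⟨v, ?_, hvw⟩
    simp only [A, Finset.mem_union, Finset.mem_image, Finset.mem_product, Finset.mem_singleton,
      Finset.mem_Icc]
    rcases hcases with ⟨h₁, h₂⟩ | ⟨h₁, h₂, h₃⟩ | ⟨h₁, h₂, h₃⟩ | ⟨h₁, h₂, h₃, h₄⟩
    · exact Or.inr ⟨h₁, h₂⟩
    · refine Or.inl (Or.inl (Or.inl ⟨(v - y, v - y + t), ?_, by simp⟩))
      rw [hW, mem_arcsAfter]
      exact ⟨by simpa using h₁, by simpa using h₂, by simp only; omega, by simpa using hv⟩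
    · refine Or.inl (Or.inr ⟨(v - z, v - z + t), ?_, by simp⟩)
      rw [mem_pairsLE]
      simp only
      omega
    · refine Or.inl (Or.inl (Or.inr ⟨(x - v - t, x - v), ?_, by simp⟩))
      rw [hZ, mem_arcsBefore p₂]
      refine ⟨by simp only; omega, by simp only; omega, by simp only; omega, by simp only; omega,
        by simpa using hv⟩
  · rw [hC]
    nlinarith [mul_nonneg p₀ p₁, mul_nonneg p₀ p₂, mul_nonneg p₁ p₂]
  · intro heq h32
    rw [hC] at heq
    have q₂ : c₂ = 0 := by
      nlinarith [mul_nonneg p₀ p₁, mul_nonneg p₀ p₂, mul_nonneg p₁ p₂]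
    have q₁ : c₁ = 0 := by
      have : c₀ * c₁ ≤ 0 := by nlinarith
      have : c₁ ≤ c₀ := by omega
      nlinarith
    have hfull : W ∪ Z.image (conflictMap c₀) = pairsLE c₀ := by
      refine Finset.eq_of_subset_of_card_le hsub ?_
      zify
      rw [← hcard]
      subst q₂ q₁
      nlinarith
    have hmem : ∀ p ∈ pairsLE c₀, p ∈ W ∨ ∃ q ∈ Z, conflictMap c₀ q = p := fun p hp => by
      rwa [← hfull, Finset.mem_union, Finset.mem_image] at hp
    rcases hmem (0, c₀) (mem_pairsLE.2 ⟨le_rfl, p₀, le_rfl⟩) with hp | ⟨⟨s, e⟩, hq, hqp⟩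
    · obtain ⟨-, -, -, hp⟩ := mem_arcsAfter.1 hp
      refine ⟨y, fun w t hw => ?_⟩
      obtain ⟨v, hv, hvw, g | g | g | g⟩ := hpos w t hw
      · refine ⟨v + (n + k), ?_, by omega⟩
        rw [add_sub_right_comm]
        exact hvw.add dvd_rfl
      · exact ⟨v, hvw, by omega⟩
      · exact ⟨v, hvw, by omega⟩
      · exact (h.conflict hP hkn hv hp (by omega) (by omega) (by omega) (by omega) (by omega)
          (by omega)).elim
    · rw [hZ, mem_arcsBefore p₂] at hq
      simp only at hq
      have hse : s = 1 ∧ e = c₀ := by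
        simp only [conflictMap] at hqp
        split_ifs at hqp <;> rw [Prod.mk.injEq] at hqp <;> omega
      obtain ⟨rfl, rfl⟩ := hse
      rcases hmem (1, 1) (mem_pairsLE.2 ⟨by simp, le_rfl, by simp only; omega⟩) with
        hp | ⟨⟨s', e'⟩, hq', hqp'⟩
      · obtain ⟨-, -, -, hp⟩ := mem_arcsAfter.1 hp
        refine (h.conflict hP hkn hq.2.2.2.2 hp ?_ ?_ ?_ ?_ ?_ ?_).elim <;> omega
      · rw [hZ, mem_arcsBefore p₂] at hq'
        simp only at hq'
        have hse : s' = 0 ∧ e' = e := by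
          simp only [conflictMap] at hqp'
          split_ifs at hqp' <;> rw [Prod.mk.injEq] at hqp' <;> omega
        obtain ⟨rfl, rfl⟩ := hse
        refine ⟨x - e', fun w t hw => ?_⟩
        obtain ⟨v, hv, hvw, g | g | g | g⟩ := hpos w t hw
        · exact ⟨v, hvw, by omega⟩
        · refine ⟨v, hvw, Or.inr (Or.inl ?_)⟩
          by_contra hc
          exact h.conflict hP hkn hq'.2.2.2.2 hv (by omega) (by omega) (by omega) (by omega)
            (by omega) (by omega)
        · exact ⟨v, hvw, by omega⟩
        · exact ⟨v, hvw, by omega⟩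

end Crown

namespace Crown

variable {n k : ℕ} {S : Set (CritPair (Crown n k))}

/-- The arcs `[i, i + t]` on the line that represent the critical pairs `(a_i, b_{i+t})` in `S`. -/
def arcs (S : Set (CritPair (Crown n k))) (i t : ℤ) : Prop :=
  0 ≤ t ∧ t ≤ k ∧ ((a (i : ZMod (n + k)), b ((i + t : ℤ) : ZMod (n + k))) : Crown n k × Crown n k) ∈
    Subtype.val '' S

theorem exists_arcs (hkn : k < n) (hk : 0 < k) {p : Crown n k × Crown n k}
    (hp : p ∈ Subtype.val '' S) (i : ℤ) : ∃ j u : ℤ, i ≤ j ∧ j < i + (n + k) ∧ arcs S j u ∧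
      p = (a (j : ZMod (n + k)), b ((j + u : ℤ) : ZMod (n + k))) := by
  obtain ⟨v, hv, rfl⟩ := id hp
  obtain ⟨x, y, hx, hy, hxy⟩ := exists_of_isCriticalPair hkn hk v.2
  obtain ⟨j, rfl, h₁, h₂⟩ := exists_intCast_eq (by omega) i x
  obtain ⟨l, rfl, h₃, h₄⟩ := inInterval_intCast_iff.1 hxy
  have e : v.1 = (a (j : ZMod (n + k)), b ((j + (l - j) : ℤ) : ZMod (n + k))) := by
    rw [add_sub_cancel, ← hx, ← hy]
  exact ⟨j, l - j, h₁, h₂, ⟨by omega, by omega, e ▸ hp⟩, e⟩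

theorem not_le_or_not_le (hkn : k < n) (hk : 0 < k) (hS : (graph n k).IsIndepSet S) 
    {p q : Crown n k × Crown n k} (hp : p ∈ Subtype.val '' S) (hq : q ∈ Subtype.val '' S) :
    ¬ p.1 ≤ q.2 ∨ ¬ q.1 ≤ p.2 := by
  obtain ⟨v, hv, rfl⟩ := hp
  obtain ⟨w, hw, rfl⟩ := hq
  by_contra! hc
  by_cases hvw : v = w
  · subst hvw
    exact v.2.1.1 hc.1
  · obtain ⟨i, j, hi, hj, -⟩ := exists_of_isCriticalPair hkn hk v.2
    obtain ⟨i', j', hi', hj', -⟩ := exists_of_isCriticalPair hkn hk w.2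
    exact hS hv hw hvw ⟨lt_of_le_of_ne hc.1 (by simp [hi, hj']),
      lt_of_le_of_ne hc.2 (by simp [hi', hj])⟩

theorem isArcFamily_arcs (hkn : k < n) (hk : 0 < k) (hS : (graph n k).IsIndepSet S) :
    IsArcFamily n k (arcs S) where
  nonneg h := h.1
  le h := h.2.1
  add := by
    rintro i t ⟨h₁, h₂, h₃⟩
    refine ⟨h₁, h₂, ?_⟩
    rwa [add_right_comm, intCast_add_modulus, intCast_add_modulus]
  sub := by
    rintro i t ⟨h₁, h₂, h₃⟩
    refine ⟨h₁, h₂, ?_⟩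
    rwa [← intCast_add_modulus, sub_add_cancel, ← intCast_add_modulus (i - _ + t), add_right_comm,
      sub_add_cancel]
  near := by
    rintro i t j u ⟨h₁, h₂, h₃⟩ ⟨g₁, g₂, g₃⟩ hij hjk
    rcases not_le_or_not_le hkn hk hS h₃ g₃ with h | h
    · obtain ⟨l, hl, hl₁, hl₂⟩ := inInterval_intCast_iff.1 (not_not.1 (mt a_le_b_iff.2 h))
      have := intCast_eq_of_lt hl (by omega) (by omega)
      omega
    · obtain ⟨l, hl, hl₁, hl₂⟩ := inInterval_intCast_iff.1 (not_not.1 (mt a_le_b_iff.2 h))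
      have := intCast_eq_of_lt hl (by omega) (by omega)
      omega
  far := by
    rintro i t j u ⟨h₁, h₂, h₃⟩ ⟨g₁, g₂, g₃⟩ hij hjk
    rcases not_le_or_not_le hkn hk hS h₃ g₃ with h | h
    · obtain ⟨l, hl, hl₁, hl₂⟩ := inInterval_intCast_iff.1 (not_not.1 (mt a_le_b_iff.2 h))
      have := intCast_eq_of_lt hl (by omega) (by omega)
      omega
    · obtain ⟨l, hl, hl₁, hl₂⟩ := inInterval_intCast_iff.1 (not_not.1 (mt a_le_b_iff.2 h))
      have := intCast_eq_of_lt hl (by omega) (by omega)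
      omega

/-- Three windows of `k + 1` points that each miss exactly one of four points, the missed points
being distinct, cannot exist on a circle of more than `2 * k` points. -/
theorem false_of_three_windows (hkn : k < n) {x₁ x₂ x₃ y₁ y₂ y₃ y₄ : ZMod (n + k)}
    (h₁₁ : InInterval n k x₁ y₁) (h₁₂ : ¬ InInterval n k x₁ y₂) (h₁₃ : InInterval n k x₁ y₃)
    (h₁₄ : InInterval n k x₁ y₄) (h₂₁ : InInterval n k x₂ y₁) (h₂₂ : InInterval n k x₂ y₂)
    (h₂₃ : ¬ InInterval n k x₂ y₃) (h₂₄ : InInterval n k x₂ y₄) (h₃₁ : InInterval n k x₃ y₁)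
    (h₃₂ : InInterval n k x₃ y₂) (h₃₃ : InInterval n k x₃ y₃)
    (h₃₄ : ¬ InInterval n k x₃ y₄) : False := by
  obtain ⟨i₁, rfl, -⟩ := exists_intCast_eq (by omega) 0 x₁
  obtain ⟨j₁, rfl, a₁, b₁⟩ := inInterval_intCast_iff.1 h₁₁
  obtain ⟨j₃, rfl, a₃, b₃⟩ := inInterval_intCast_iff.1 h₁₃
  obtain ⟨j₄, rfl, a₄, b₄⟩ := inInterval_intCast_iff.1 h₁₄
  obtain ⟨j₂, rfl, a₂, b₂⟩ := exists_intCast_eq (by omega) i₁ y₂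
  obtain ⟨i₂, rfl, c₁, c₂⟩ := inInterval_iff_exists_left.1 h₂₁
  obtain ⟨i₃, rfl, d₁, d₂⟩ := inInterval_iff_exists_left.1 h₃₁
  obtain ⟨l₄, hl₄, e₁, e₂⟩ := inInterval_intCast_iff.1 h₂₄
  have := intCast_eq_of_lt hl₄ (by omega) (by omega)
  obtain ⟨l₃, hl₃, f₁, f₂⟩ := inInterval_intCast_iff.1 h₃₃
  have := intCast_eq_of_lt hl₃ (by omega) (by omega)
  have g₁ : ¬ (i₁ ≤ j₂ ∧ j₂ ≤ i₁ + k) := fun h => h₁₂ (inInterval_intCast_iff.2 ⟨j₂, rfl, h⟩)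
  have g₂ : ¬ (i₂ ≤ j₃ ∧ j₃ ≤ i₂ + k) := fun h => h₂₃ (inInterval_intCast_iff.2 ⟨j₃, rfl, h⟩)
  have g₃ : ¬ (i₃ ≤ j₄ ∧ j₄ ≤ i₃ + k) := fun h => h₃₄ (inInterval_intCast_iff.2 ⟨j₄, rfl, h⟩)
  have key : ∀ i : ℤ, InInterval n k i j₂ → i ≤ j₁ → j₁ ≤ i + k →
      (i ≤ j₂ ∧ j₂ ≤ i + k) ∨ (i + (n + k) ≤ j₂ ∧ j₂ ≤ i + (n + k) + k) := by
    intro i hi hi₁ hi₂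
    obtain ⟨l, hl, m₁, m₂⟩ := inInterval_intCast_iff.1 hi
    rcases lt_or_ge j₂ (l + (n + k)) with hlt | hge
    · have := intCast_eq_of_lt hl (by omega) (by omega)
      omega
    · have := intCast_eq_of_lt ((intCast_add_modulus l).trans hl) (by omega) (by omega)
      omega
  have k₂ := key i₂ h₂₂ c₁ c₂
  have k₃ := key i₃ h₃₂ d₁ d₂
  omega

theorem exists_three_cycle (hkn : k < n) (hk : 0 < k) (hS : IsINR S) :
    ∃ p ∈ Subtype.val '' S, ∃ q ∈ Subtype.val '' S, ∃ r ∈ Subtype.val '' S,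
      p.1 ≤ q.2 ∧ q.1 ≤ r.2 ∧ r.1 ≤ p.2 := by
  by_contra! hc
  obtain ⟨hS, hrev⟩ := hS
  refine hrev (isReversible_of_forall_not_transGen fun p hp => ?_)
  set A : Crown n k × Crown n k → Crown n k × Crown n k → Prop :=
    fun p q => p ∈ Subtype.val '' S ∧ q ∈ Subtype.val '' S ∧ p.1 ≤ q.2
  have asymm : ∀ {p q}, A p q → ¬ q.1 ≤ p.2 := fun h h' =>
    (not_le_or_not_le hkn hk hS h.1 h.2.1).elim (fun g => g h.2.2) (fun g => g h')
  have short : ∀ {p q r s}, A p q → A q r → A r s → A p r ∨ A q s ∨ A p s := by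
    intro p q r s hpq hqr hrs
    by_contra! hcon
    obtain ⟨c₁, c₂, c₃⟩ := hcon
    have c₁ : ¬ p.1 ≤ r.2 := fun h => c₁ ⟨hpq.1, hqr.2.1, h⟩
    have c₂ : ¬ q.1 ≤ s.2 := fun h => c₂ ⟨hqr.1, hrs.2.1, h⟩
    have c₃ : ¬ p.1 ≤ s.2 := fun h => c₃ ⟨hpq.1, hrs.2.1, h⟩
    have c₄ := asymm hpq
    have c₅ := asymm hqr
    have c₆ := hc p hpq.1 q hpq.2.1 r hqr.2.1 hpq.2.2 hqr.2.2
    have hself : ∀ p ∈ Subtype.val '' S, ¬ p.1 ≤ p.2 := by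
      rintro _ ⟨v, -, rfl⟩
      exact v.2.1.1
    have hp' := hself p hpq.1
    have hq' := hself q hqr.1
    have hr' := hself r hrs.1
    have e₁ := hpq.2.2
    have e₂ := hqr.2.2
    have e₃ := hrs.2.2
    obtain ⟨i₁, t₁, -, -, -, rfl⟩ := exists_arcs hkn hk hpq.1 0
    obtain ⟨i₂, t₂, -, -, -, rfl⟩ := exists_arcs hkn hk hqr.1 0
    obtain ⟨i₃, t₃, -, -, -, rfl⟩ := exists_arcs hkn hk hrs.1 0
    obtain ⟨i₄, t₄, -, -, -, rfl⟩ := exists_arcs hkn hk hrs.2.1 0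
    simp only [a_le_b_iff, not_not] at *
    exact false_of_three_windows hkn hp' e₁ c₁ c₃ c₄ hq' e₂ c₂ c₆ c₅ hr' e₃
  have two : ∀ {q}, Relation.TransGen A p q → A p q ∨ ∃ r, A p r ∧ A r q := by
    intro q h
    induction h with
    | single h => exact Or.inl h
    | tail _ h ih =>
      rcases ih with ih | ⟨r, h₁, h₂⟩
      · exact Or.inr ⟨_, ih, h⟩
      · rcases short h₁ h₂ h with g | g | g
        · exact Or.inr ⟨_, g, h⟩
        · exact Or.inr ⟨_, h₁, g⟩
        · exact Or.inl g
  rcases two hp with h | ⟨r, h₁, h₂⟩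
  · exact asymm h h.2.2
  · exact asymm h₁ h₂.2.2

/-- If `a_i` lies below the second entry of a pair of `S`, that pair starts at distance at most
`k` from `i`, on either side. -/
theorem exists_arcs_of_le (hkn : k < n) (hk : 0 < k) (hS : (graph n k).IsIndepSet S) {i t : ℤ}
    (hi : arcs S i t) {q : Crown n k × Crown n k} (hq : q ∈ Subtype.val '' S)
    (h : a (i : ZMod (n + k)) ≤ q.2) : ∃ j u : ℤ, arcs S j u ∧
      q = (a (j : ZMod (n + k)), b ((j + u : ℤ) : ZMod (n + k))) ∧
      ((i < j ∧ j ≤ i + k ∧ j ≤ i + t ∧ i + k < j + u) ∨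
        (j < i ∧ i ≤ j + k ∧ j + u < i ∧ i + t ≤ j + k)) := by
  have hP := isArcFamily_arcs hkn hk hS
  obtain ⟨j, u, h₁, h₂, hj, rfl⟩ := exists_arcs hkn hk hq i
  have hnot : ∀ l : ℤ, (l : ZMod (n + k)) = ((j + u : ℤ) : ZMod (n + k)) →
      ¬ (i ≤ l ∧ l ≤ i + k) := fun l hl hl' =>
    a_le_b_iff.1 h (inInterval_intCast_iff.2 ⟨l, hl, hl'⟩)
  have n₁ := hnot _ rfl
  have u₀ := hj.1
  have u₁ := hj.2.1
  rcases le_or_gt j (i + k) with hjk | hjk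
  · have hne : i ≠ j := by
      rintro rfl
      omega
    have := hP.near hi hj (by omega) hjk
    exact ⟨j, u, hj, rfl, by omega⟩
  · have hjn : i + n ≤ j := by
      by_contra hc
      exact hP.far hi hj hjk (by omega)
    have hj' := hP.sub hj
    have e₁ : ((j - (n + k) : ℤ) : ZMod (n + k)) = (j : ZMod (n + k)) := by
      rw [← intCast_add_modulus, sub_add_cancel]
    have e₂ : ((j - (n + k) + u : ℤ) : ZMod (n + k)) = ((j + u : ℤ) : ZMod (n + k)) := by
      rw [← intCast_add_modulus]
      congr 1
      ring
    have n₂ := hnot _ e₂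
    have := hP.near hj' hi (by omega) (by omega)
    exact ⟨j - (n + k), u, hj', by rw [e₁, e₂], by omega⟩

theorem isIndepSet_image_map (f : Crown n k ≃o Crown n k) (hS : (graph n k).IsIndepSet S) :
    (graph n k).IsIndepSet (CritPair.map f '' S) := by
  rintro _ ⟨v, hv, rfl⟩ _ ⟨w, hw, rfl⟩ hne hadj
  refine hS hv hw (fun h => hne (h ▸ rfl)) ⟨?_, ?_⟩
  · simpa [CritPair.map] using hadj.1
  · simpa [CritPair.map] using hadj.2

theorem arcs_image_reflection {i t : ℤ} (h : arcs S i t) :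
    arcs (CritPair.map reflection '' S) (-i) (k - t) := by
  obtain ⟨h₁, h₂, v, hv, hv'⟩ := h
  refine ⟨by omega, by omega, CritPair.map reflection v, ⟨v, hv, rfl⟩, ?_⟩
  simp only [CritPair.map, hv', Prod.mk.injEq]
  refine ⟨?_, ?_⟩
  · change a _ = a _
    push_cast
    rfl
  · change b _ = b _
    push_cast
    congr 1
    ring

/-- An independent non-reversible set, or its reflection, has a triangle of disjoint arcs. -/
theorem exists_isTriangle (hkn : k < n) (hk : 0 < k) (hS : IsINR S) :
    (∃ x y z, IsTriangle n k (arcs S) x y z) ∨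
      ∃ x y z, IsTriangle n k (arcs (CritPair.map reflection '' S)) x y z := by
  obtain ⟨p, hp, q, hq, r, hr, hpq, hqr, hrp⟩ := exists_three_cycle hkn hk hS
  obtain ⟨i₁, t₁, -, -, h₁, rfl⟩ := exists_arcs hkn hk hp 0
  obtain ⟨i₂, t₂, h₂, rfl, c₁⟩ := exists_arcs_of_le hkn hk hS.1 h₁ hq hpq
  obtain ⟨i₃, t₃, h₃, rfl, c₂⟩ := exists_arcs_of_le hkn hk hS.1 h₂ hr hqr
  obtain ⟨i₄, t₄, h₄, heq, c₃⟩ := exists_arcs_of_le hkn hk hS.1 h₃ hp hrp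
  simp only [Prod.mk.injEq, a.injEq, b.injEq] at heq
  obtain ⟨e₁, e₂⟩ := heq
  have ht : t₁ = t₄ := by
    refine intCast_eq_of_lt (n := n) (k := k) ?_ ?_ ?_
    · push_cast at e₂
      linear_combination e₂ - e₁
    · have := h₁.2.1
      have := h₄.1
      omega
    · have := h₁.1
      have := h₄.2.1
      omega
  obtain ⟨Q, hQ⟩ := (ZMod.intCast_eq_intCast_iff_dvd_sub _ _ _).1 e₁
  push_cast at hQ
  have hQ' : i₄ = i₁ - (n + k) ∨ i₄ = i₁ ∨ i₄ = i₁ + (n + k) := by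
    have : -(3 * k) ≤ i₄ - i₁ := by omega
    have : i₄ - i₁ ≤ 3 * k := by omega
    have : -2 < Q := by nlinarith
    have : Q < 2 := by nlinarith
    obtain rfl | rfl | rfl : Q = -1 ∨ Q = 0 ∨ Q = 1 := by omega
    all_goals omega
  have := h₁.1
  have := h₁.2.1
  rcases c₁ with c₁ | c₁ <;> rcases c₂ with c₂ | c₂ <;> rcases c₃ with c₃ | c₃ <;> try omega
  · exact Or.inr ⟨_, _, _, _, _, _, arcs_image_reflection h₄, arcs_image_reflection h₃,
      arcs_image_reflection h₂, by omega⟩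
  · exact Or.inl ⟨_, _, _, _, _, _, h₄, h₃, h₂, by omega⟩

end Crown

namespace Crown

variable {n k : ℕ} {S : Set (CritPair (Crown n k))}

theorem finite_crown (hm : 0 < n + k) : Finite (Crown n k) := by
  have : NeZero (n + k) := ⟨hm.ne'⟩
  refine Finite.of_injective
    (fun x : Crown n k => (match x with | a i => Sum.inl i | b i => Sum.inr i :
      ZMod (n + k) ⊕ ZMod (n + k))) ?_
  rintro (i | i) (j | j) h <;> simp_all

theorem map_injective (f : Crown n k ≃o Crown n k) :
    Function.Injective (CritPair.map f) := by
  intro v w h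
  simpa [CritPair.map, Subtype.ext_iff, Prod.ext_iff] using h

theorem mem_extremalSet_of_eq (hkn : k < n) (hnk : n ≤ 2 * k) {v : CritPair (Crown n k)} {i t : ℤ}
    (hv : v.1 = (a (i : ZMod (n + k)), b ((i + t : ℤ) : ZMod (n + k)))) (ht : 0 ≤ t)
    (h : (1 ≤ i ∧ i + t ≤ 2 * k + 1 - n) ∨ (i = k + 1 ∧ t = 0) ∨ (i = 2 * k + 1 ∧ t = 0)) :
    v ∈ extremalSet n k := by
  have : NeZero (n + k) := ⟨by omega⟩
  refine ⟨_, _, hv, ?_⟩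
  have hval : ∀ e : ℕ, e < n + k → ((e : ℕ) : ZMod (n + k)).val = e := fun e he =>
    ZMod.val_cast_of_lt he
  rcases h with ⟨h₁, h₂⟩ | ⟨rfl, rfl⟩ | ⟨rfl, rfl⟩
  · refine ⟨_, Or.inl rfl, ?_⟩
    obtain ⟨e, rfl⟩ : ∃ e : ℕ, i = 1 + e := ⟨(i - 1).toNat, by omega⟩
    obtain ⟨t, rfl⟩ := Int.eq_ofNat_of_zero_le ht
    have e₁ : (((1 + e : ℤ) : ZMod (n + k)) - 1) = (e : ℕ) := by push_cast; ring
    have e₂ : (((1 + e + t : ℤ) : ZMod (n + k)) - 1) = ((e + t : ℕ) : ZMod (n + k)) := by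
      push_cast; ring
    have e₃ : (((2 * k + 1 - n : ℕ) : ZMod (n + k)) - 1) = ((2 * k - n : ℕ) : ZMod (n + k)) := by
      rw [show 2 * k + 1 - n = (2 * k - n) + 1 by omega]
      push_cast; ring
    simp only
    rw [e₁, e₂, e₃, hval _ (by omega), hval _ (by omega), hval _ (by omega)]
    omega
  · exact ⟨_, Or.inr (Or.inl rfl), by simp⟩
  · exact ⟨_, Or.inr (Or.inr rfl), by simp⟩

theorem exists_of_mem_extremalSet (hkn : k < n) (hnk : n ≤ 2 * k) {v : CritPair (Crown n k)}
    (h : v ∈ extremalSet n k) : ∃ i t : ℤ,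
      v.1 = (a (i : ZMod (n + k)), b ((i + t : ℤ) : ZMod (n + k))) ∧ 0 ≤ t ∧
      ((1 ≤ i ∧ i + t ≤ 2 * k + 1 - n) ∨ (i = k + 1 ∧ t = 0) ∨ (i = 2 * k + 1 ∧ t = 0)) := by
  have : NeZero (n + k) := ⟨by omega⟩
  obtain ⟨x, y, hv, c, hc, h₁, h₂⟩ := h
  have hx : x = c.1 + ((x - c.1).val : ZMod (n + k)) := by rw [ZMod.natCast_zmod_val]; ring
  have hy : y = c.1 + ((y - c.1).val : ZMod (n + k)) := by rw [ZMod.natCast_zmod_val]; ring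
  rcases hc with rfl | rfl | rfl
  · have e₃ : (((2 * k + 1 - n : ℕ) : ZMod (n + k)) - 1).val = 2 * k - n := by
      rw [show 2 * k + 1 - n = (2 * k - n) + 1 by omega, Nat.cast_add, Nat.cast_one,
        add_sub_cancel_right]
      exact ZMod.val_cast_of_lt (by omega)
    simp only at hx hy h₁ h₂
    rw [e₃] at h₂
    refine ⟨1 + (x - 1).val, (y - 1).val - (x - 1).val, ?_, by omega, Or.inl (by omega)⟩
    rw [hv]
    congr 2
    · rw [hx]; push_cast; simp
    · rw [hy]; push_cast; simp
  · simp only [sub_self, ZMod.val_zero, Nat.le_zero] at h₂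
    rw [h₂, Nat.le_zero] at h₁
    rw [h₁] at hx
    rw [h₂] at hy
    refine ⟨k + 1, 0, ?_, le_rfl, by omega⟩
    rw [hv, hx, hy]
    simp
  · simp only [sub_self, ZMod.val_zero, Nat.le_zero] at h₂
    rw [h₂, Nat.le_zero] at h₁
    rw [h₁] at hx
    rw [h₂] at hy
    refine ⟨2 * k + 1, 0, ?_, le_rfl, by omega⟩
    rw [hv, hx, hy]
    simp

theorem isIndepSet_extremalSet (hkn : k < n) (hnk : n ≤ 2 * k) :
    (graph n k).IsIndepSet (extremalSet n k) := by
  rintro v hv w hw - hadj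
  obtain ⟨i, t, hi, ht, h⟩ := exists_of_mem_extremalSet hkn hnk hv
  obtain ⟨j, u, hj, hu, g⟩ := exists_of_mem_extremalSet hkn hnk hw
  obtain ⟨h₁, h₂⟩ := hadj
  rw [hi, hj] at h₁ h₂
  have c : ∀ {i j : ℤ}, (a (i : ZMod (n + k)) : Crown n k) < b (j : ZMod (n + k)) →
      ¬ (i ≤ j ∧ j ≤ i + k) ∧ ¬ (i ≤ j + (n + k) ∧ j + (n + k) ≤ i + k) := fun {i j} hij =>
    ⟨fun h => a_lt_b_iff.1 hij (inInterval_intCast_iff.2 ⟨j, rfl, h⟩),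
      fun h => a_lt_b_iff.1 hij (inInterval_intCast_iff.2 ⟨_, intCast_add_modulus j, h⟩)⟩
  have := c h₁
  have := c h₂
  omega

theorem not_isReversible_extremalSet (hkn : k < n) (hnk : n ≤ 2 * k) :
    ¬ IsReversible (Subtype.val '' extremalSet n k) := by
  rintro ⟨L, hL, hrev⟩
  have mem : ∀ i : ℤ, i = 1 ∨ i = k + 1 ∨ i = 2 * k + 1 →
      L.lt (b (i : ZMod (n + k))) (a (i : ZMod (n + k))) := fun i hi =>
    hrev (a (i : ZMod (n + k)), b (i : ZMod (n + k)))
      ⟨⟨_, isCriticalPair_a_b (inInterval_self _)⟩,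
        mem_extremalSet_of_eq hkn hnk (i := i) (t := 0) (by simp) le_rfl (by omega), rfl⟩
  have le : ∀ i j l : ℤ, l = j ∨ l = j + (n + k) → i + k < l → l < i + (n + k) →
      L.le (a (i : ZMod (n + k))) (b (j : ZMod (n + k))) := by
    intro i j l hl h₁ h₂
    refine hL _ _ (a_le_b_iff.2 fun h => ?_)
    have hl' : (l : ZMod (n + k)) = j := by
      rcases hl with rfl | rfl
      · rfl
      · exact intCast_add_modulus j
    obtain ⟨q, hq, q₁, q₂⟩ := inInterval_intCast_iff.1 h
    have := intCast_eq_of_lt (hq.trans hl'.symm) (by omega) (by omega)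
    omega
  have h₁ := le 1 (2 * k + 1) (2 * k + 1) (by omega) (by omega) (by omega)
  have h₂ := le (2 * k + 1) (k + 1) (k + 1 + (n + k)) (by omega) (by omega) (by omega)
  have h₃ := le (k + 1) 1 (1 + (n + k)) (by omega) (by omega) (by omega)
  have g₁ := mem 1 (by omega)
  have g₂ := mem (k + 1) (by omega)
  have g₃ := mem (2 * k + 1) (by omega)
  let := L.toPartialOrder.toPreorder
  exact lt_irrefl _ (h₁.trans_lt (g₃.trans_le h₂) |>.trans (g₂.trans_le h₃) |>.trans g₁)

theorem le_ncard_extremalSet (hkn : k < n) (hnk : n ≤ 2 * k) :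
    4 + (2 * k - n + 1 : ℤ) * (2 * k - n + 2) ≤ 2 * ((extremalSet n k).ncard : ℤ) := by
  have := finite_crown (n := n) (k := k) (by omega)
  classical
  let F : Finset (ℤ × ℤ) := pairsLE (2 * k - n) ∪ {((k : ℤ), (k : ℤ)), (2 * (k : ℤ), 2 * (k : ℤ))}
  let g : ℤ × ℤ → Crown n k × Crown n k := fun p =>
    (a ((1 + p.1 : ℤ) : ZMod (n + k)), b ((1 + p.2 : ℤ) : ZMod (n + k)))
  have hF : ∀ p ∈ F, (0 ≤ p.1 ∧ p.1 ≤ p.2 ∧ p.2 ≤ 2 * k - n) ∨ (p.1 = k ∧ p.2 = k) ∨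
      (p.1 = 2 * k ∧ p.2 = 2 * k) := by
    intro p hp
    simp only [F, Finset.mem_union, mem_pairsLE, Finset.mem_insert, Finset.mem_singleton,
      Prod.ext_iff] at hp
    exact hp
  have hcard : (F.card : ℤ) = (pairsLE (2 * k - n)).card + 2 := by
    rw [Finset.card_union_of_disjoint, Finset.card_pair]
    · push_cast
      rfl
    · rw [Ne, Prod.mk.injEq]
      omega
    · rw [Finset.disjoint_left]
      intro p hp hp'
      simp only [mem_pairsLE, Finset.mem_insert, Finset.mem_singleton, Prod.ext_iff] at hp hp'
      omega
  have hinj : Set.InjOn g F := by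
    intro p hp q hq h
    have h₁ := hF p hp
    have h₂ := hF q hq
    simp only [g, Prod.mk.injEq, a.injEq, b.injEq] at h
    have e₁ := intCast_eq_of_lt h.1 (by omega) (by omega)
    have e₂ := intCast_eq_of_lt h.2 (by omega) (by omega)
    ext <;> omega
  have hsub : g '' F ⊆ Subtype.val '' extremalSet n k := by
    rintro _ ⟨p, hp, rfl⟩
    have h := hF p hp
    have hc : InInterval n k ((1 + p.1 : ℤ) : ZMod (n + k)) ((1 + p.2 : ℤ) : ZMod (n + k)) :=
      inInterval_intCast_iff.2 ⟨_, rfl, by omega, by omega⟩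
    refine ⟨⟨_, isCriticalPair_a_b hc⟩, ?_, rfl⟩
    refine mem_extremalSet_of_eq hkn hnk (i := 1 + p.1) (t := p.2 - p.1) ?_ (by omega) (by omega)
    simp
  have h₁ := Set.ncard_le_ncard hsub (Set.toFinite _)
  rw [hinj.ncard_image, Set.ncard_coe_finset,
    Set.ncard_image_of_injective _ Subtype.val_injective] at h₁
  have h₂ := two_mul_card_pairsLE (c := 2 * k - n) (by omega)
  have : (F.card : ℤ) ≤ (extremalSet n k).ncard := by exact_mod_cast h₁
  linarith

/-- The bound and its equality case for independent sets with a triangle of disjoint arcs. -/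
theorem IsTriangle.two_mul_ncard_le (hkn : k < n) (hnk : n ≤ 2 * k)
    (hS : (graph n k).IsIndepSet S) {x y z : ℤ} (h : IsTriangle n k (arcs S) x y z) :
    2 * (S.ncard : ℤ) ≤ 4 + (2 * k - n + 1 : ℤ) * (2 * k - n + 2) ∧
      (2 * (S.ncard : ℤ) = 4 + (2 * k - n + 1 : ℤ) * (2 * k - n + 2) → (n, k) ≠ (3, 2) →
        ∃ j, S ⊆ CritPair.map (rotation j) '' extremalSet n k) := by
  have hfin := finite_crown (n := n) (k := k) (by omega)
  have hk : 0 < k := by omega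
  obtain ⟨A, hA, hA', hA''⟩ := h.exists_cover (isArcFamily_arcs hkn hk hS) (by omega)
  have hcast : ∀ {v w : ℤ}, (n + k : ℤ) ∣ v - w → (v : ZMod (n + k)) = w := fun {v w} hvw => by
    rw [eq_comm, ZMod.intCast_eq_intCast_iff_dvd_sub]
    exact_mod_cast hvw
  have hle : S.ncard ≤ A.card := by
    rw [← Set.ncard_image_of_injective S Subtype.val_injective, ← Set.ncard_coe_finset A]
    refine le_trans (Set.ncard_le_ncard (t := (fun p : ℤ × ℤ =>
      ((a (p.1 : ZMod (n + k)), b ((p.1 + p.2 : ℤ) : ZMod (n + k))) : Crown n k × Crown n k)) ''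
        A) ?_ (Set.toFinite _)) (Set.ncard_image_le (Set.toFinite _))
    intro p hp
    obtain ⟨w, t, -, -, hw, rfl⟩ := exists_arcs hkn hk hp 0
    obtain ⟨v, hv, hvw⟩ := hA w t hw
    refine ⟨(v, t), hv, ?_⟩
    push_cast
    rw [hcast hvw]
  refine ⟨by linarith [(by exact_mod_cast hle : (S.ncard : ℤ) ≤ A.card)], fun heq h32 => ?_⟩
  have hle' : (S.ncard : ℤ) ≤ A.card := by exact_mod_cast hle
  obtain ⟨y, hy⟩ := hA'' (by linarith) (fun hc => h32 (Prod.ext (by omega) (by omega)))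
  refine ⟨((y - 1 : ℤ) : ZMod (n + k)), fun s hs => ?_⟩
  obtain ⟨w, t, -, -, hw, hsw⟩ := exists_arcs hkn hk ⟨s, hs, rfl⟩ 0
  obtain ⟨v, hvw, hv⟩ := hy w t hw
  have t₀ := hw.1
  have t₁ := hw.2.1
  have hc : InInterval n k ((v - y + 1 : ℤ) : ZMod (n + k)) ((v - y + 1 + t : ℤ) : ZMod (n + k)) :=
    inInterval_intCast_iff.2 ⟨_, rfl, by omega, by omega⟩
  refine ⟨⟨_, isCriticalPair_a_b hc⟩,
    mem_extremalSet_of_eq hkn hnk (i := v - y + 1) (t := t) rfl t₀ (by omega), ?_⟩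
  apply Subtype.ext
  rw [hsw]
  have := hcast hvw
  refine Prod.ext ?_ ?_
  · change a _ = a _
    push_cast
    rw [this]
    congr 1
    ring
  · change b _ = b _
    push_cast
    rw [this]
    congr 1
    ring

theorem map_reflection_map_reflection (v : CritPair (Crown n k)) :
    CritPair.map reflection (CritPair.map reflection v) = v :=
  Subtype.ext (Prod.ext (reflection.left_inv _) (reflection.left_inv _))

theorem map_reflection_map_rotation (j : ZMod (n + k)) (v : CritPair (Crown n k)) :
    CritPair.map reflection (CritPair.map (rotation j) v) =
      CritPair.map (rotation (-j)) (CritPair.map reflection v) := by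
  have : ∀ x : Crown n k, reflection (rotation j x) = rotation (-j) (reflection x) := by
    rintro (i | i)
    · change a _ = a _
      congr 1
      ring
    · change b _ = b _
      congr 1
      ring
  exact Subtype.ext (Prod.ext (this _) (this _))

end Crown

theorem theorem1p4 (n k : ℕ) (hn : 3 ≤ n) (hkn : k < n) (hnk : n ≤ 2 * k) :
    (∀ S : Set (CritPair (Crown n k)), Crown.IsINR S →
      S.ncard ≤ 2 + (2 * k + 2 - n) * (2 * k + 1 - n) / 2) ∧
    (Crown.IsINR (Crown.extremalSet n k) ∧
      (Crown.extremalSet n k).ncard = 2 + (2 * k + 2 - n) * (2 * k + 1 - n) / 2) ∧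
    ((n, k) ≠ (3, 2) →
      ∀ S : Set (CritPair (Crown n k)), Crown.IsINR S →
        S.ncard = 2 + (2 * k + 2 - n) * (2 * k + 1 - n) / 2 →
        ∃ j : ZMod (n + k),
          S = CritPair.map (Crown.rotation j) '' Crown.extremalSet n k ∨
          S = CritPair.map (Crown.rotation j) ''
            (CritPair.map Crown.reflection '' Crown.extremalSet n k)) := by
  have hk : 0 < k := by omega
  have hfin := Crown.finite_crown (n := n) (k := k) (by omega)
  have hbound : 2 * ((2 + (2 * k + 2 - n) * (2 * k + 1 - n) / 2 : ℕ) : ℤ) =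
      4 + (2 * k - n + 1 : ℤ) * (2 * k - n + 2) := by
    obtain ⟨c, hc⟩ : ∃ c, 2 * k = n + c := ⟨2 * k - n, by omega⟩
    rw [show 2 * k + 2 - n = c + 1 + 1 by omega, show 2 * k + 1 - n = c + 1 by omega,
      show (2 * k - n : ℤ) = c by omega, mul_comm (c + 1 + 1)]
    have := Nat.div_two_mul_two_of_even (Nat.even_mul_succ_self (c + 1))
    zify at this
    push_cast
    linarith
  generalize 2 + (2 * k + 2 - n) * (2 * k + 1 - n) / 2 = B at *
  have upper : ∀ S : Set (CritPair (Crown n k)), Crown.IsINR S → S.ncard ≤ B := by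
    intro S hS
    rcases Crown.exists_isTriangle hkn hk hS with ⟨x, y, z, h⟩ | ⟨x, y, z, h⟩
    · have := (h.two_mul_ncard_le hkn hnk hS.1).1
      omega
    · have := (h.two_mul_ncard_le hkn hnk (Crown.isIndepSet_image_map _ hS.1)).1
      rw [Set.ncard_image_of_injective _ (Crown.map_injective _)] at this
      omega
  have hD : Crown.IsINR (Crown.extremalSet n k) :=
    ⟨Crown.isIndepSet_extremalSet hkn hnk, Crown.not_isReversible_extremalSet hkn hnk⟩
  have hDcard : (Crown.extremalSet n k).ncard = B := by
    have h₁ := upper _ hD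
    have h₂ := Crown.le_ncard_extremalSet hkn hnk
    omega
  refine ⟨upper, ⟨hD, hDcard⟩, fun h32 S hS hcard => ?_⟩
  rcases Crown.exists_isTriangle hkn hk hS with ⟨x, y, z, h⟩ | ⟨x, y, z, h⟩
  · obtain ⟨j, hj⟩ := (h.two_mul_ncard_le hkn hnk hS.1).2 (by rw [hcard, hbound]) h32
    refine ⟨j, Or.inl (Set.eq_of_subset_of_ncard_le hj ?_ (Set.toFinite _))⟩
    rw [Set.ncard_image_of_injective _ (Crown.map_injective _), hDcard, hcard]
  · have hcard' : (CritPair.map Crown.reflection '' S).ncard = B := by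
      rw [Set.ncard_image_of_injective _ (Crown.map_injective _), hcard]
    obtain ⟨j, hj⟩ := (h.two_mul_ncard_le hkn hnk (Crown.isIndepSet_image_map _ hS.1)).2
      (by rw [hcard', hbound]) h32
    refine ⟨-j, Or.inr ?_⟩
    have heq := Set.eq_of_subset_of_ncard_le hj (by
      rw [Set.ncard_image_of_injective _ (Crown.map_injective _), hDcard, hcard'])
      (Set.toFinite _)
    have := congrArg (CritPair.map Crown.reflection '' ·) heq
    simp only [Set.image_image, Crown.map_reflection_map_reflection,
      Crown.map_reflection_map_rotation, Set.image_id'] at this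
    rw [this, Set.image_image]
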